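/- Let $d,n\ge 1$ be integers, let $\mathbb D=\{z\in\mathbb C:|z|<1\}$, and let $\overline{\mathbb D}$ be its closure. Let $A(\mathbb D^d)$ be the polydisc algebra of all continuous functions $f:\overline{\mathbb D}^d\to\mathbb C$ that are holomorphic in $\mathbb D^d$, with pointwise operations, and let $A_{\mathrm{sym}}(\mathbb D^d)$ be the subalgebra of all $f\in A(\mathbb D^d)$ that are symmetric, i.e. $f(z_1,\dots,z_d)=f(z_{\sigma(1)},\dots,z_{\sigma(d)})$ for all $(z_1,\dots,z_d)\in\mathbb D^d$ and all permutations $\sigma$ of $\{1,\dots,d\}$. Let $f_1,\dots,f_n\in A_{\mathrm{sym}}(\mathbb D^d)$. Then the following are equivalent: (1) There exist $g_1,\dots,g_n\in A_{\mathrm{sym}}(\mathbb D^d)$ such that $f_1g_1+\cdots+f_ng_n=\mathbf 1$, where $\mathbf 1$ is the constant function with value $1$. (2) There exists $\delta>0$ such that $|f_1(\mathbf z)|+\cdots+|f_n(\mathbf z)|\ge\delta$ for all $\mathbf z\in\mathbb D^d$. -/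

import Mathlib

/-- The open unit polydisc `𝔻^d` in `ℂ^d`. -/
def openPolydisc (d : ℕ) : Set (Fin d → ℂ) := {z | ∀ i, ‖z i‖ < 1}

/-- The closed unit polydisc in `ℂ^d`, the `d`-fold power of the closed unit disc. -/
def closedPolydisc (d : ℕ) : Set (Fin d → ℂ) := {z | ∀ i, ‖z i‖ ≤ 1}

/-- The action `σ z = (z_{σ(1)}, …, z_{σ(d)})` of a permutation on the closed polydisc. -/
def permPoint {d : ℕ} (σ : Equiv.Perm (Fin d)) (z : closedPolydisc d) : closedPolydisc d :=
  ⟨fun i => z.1 (σ i), fun i => z.2 (σ i)⟩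

/-- `f`, given on the closed polydisc, is holomorphic in the open polydisc. The values outside
the closed polydisc of the extension by zero are irrelevant, since the open polydisc is open. -/
def IsHolomorphicInside {d : ℕ} (f : closedPolydisc d → ℂ) : Prop :=
  DifferentiableOn ℂ (Function.extend Subtype.val f 0) (openPolydisc d)

/-- `f` is symmetric: `f z = f (σ z)` for all `z` in the open polydisc and all permutations. -/
def IsSymmetricInside {d : ℕ} (f : closedPolydisc d → ℂ) : Prop :=
  ∀ z : closedPolydisc d, z.1 ∈ openPolydisc d →
    ∀ σ : Equiv.Perm (Fin d), f z = f (permPoint σ z)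

theorem openPolydisc_subset_closedPolydisc (d : ℕ) : openPolydisc d ⊆ closedPolydisc d :=
  fun _ hz i => (hz i).le

theorem isHolomorphicInside_iff {d : ℕ} (f : closedPolydisc d → ℂ) :
    IsHolomorphicInside f ↔ ∃ F : (Fin d → ℂ) → ℂ, DifferentiableOn ℂ F (openPolydisc d) ∧
      ∀ z : closedPolydisc d, z.1 ∈ openPolydisc d → F z.1 = f z := by
  constructor
  · intro h
    exact ⟨_, h, fun z _ => Subtype.val_injective.extend_apply f 0 z⟩
  · rintro ⟨F, hF, hFf⟩
    refine hF.congr fun z hz => ?_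
    have h := hFf ⟨z, openPolydisc_subset_closedPolydisc d hz⟩ hz
    have h' := Subtype.val_injective.extend_apply f 0
      (⟨z, openPolydisc_subset_closedPolydisc d hz⟩ : closedPolydisc d)
    exact h'.trans h.symm

/-- The polydisc algebra `A(𝔻^d)`: continuous functions on the closed polydisc that are
holomorphic in the open polydisc, with the pointwise operations. -/
def polydiscAlgebra (d : ℕ) : Subalgebra ℂ C(closedPolydisc d, ℂ) where
  carrier := {f | IsHolomorphicInside f}
  mul_mem' := by
    intro f g hf hg
    obtain ⟨F, hF, hFf⟩ := (isHolomorphicInside_iff _).1 hf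
    obtain ⟨G, hG, hGg⟩ := (isHolomorphicInside_iff _).1 hg
    exact (isHolomorphicInside_iff _).2
      ⟨fun z => F z * G z, hF.mul hG, fun z hz => by simp [hFf z hz, hGg z hz]⟩
  add_mem' := by
    intro f g hf hg
    obtain ⟨F, hF, hFf⟩ := (isHolomorphicInside_iff _).1 hf
    obtain ⟨G, hG, hGg⟩ := (isHolomorphicInside_iff _).1 hg
    exact (isHolomorphicInside_iff _).2
      ⟨fun z => F z + G z, hF.add hG, fun z hz => by simp [hFf z hz, hGg z hz]⟩
  algebraMap_mem' := by
    intro c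
    exact (isHolomorphicInside_iff _).2
      ⟨fun _ => c, differentiableOn_const c, fun z _ => by simp⟩

/-- The algebra `A_sym(𝔻^d)` of the symmetric functions in the polydisc algebra. -/
def symPolydiscAlgebra (d : ℕ) : Subalgebra ℂ C(closedPolydisc d, ℂ) where
  carrier := {f | f ∈ polydiscAlgebra d ∧ IsSymmetricInside f}
  mul_mem' := by
    intro f g hf hg
    refine ⟨mul_mem hf.1 hg.1, fun z hz σ => ?_⟩
    simp only [ContinuousMap.mul_apply, ← hf.2 z hz σ, ← hg.2 z hz σ]
  add_mem' := by
    intro f g hf hg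
    refine ⟨add_mem hf.1 hg.1, fun z hz σ => ?_⟩
    simp only [ContinuousMap.add_apply, ← hf.2 z hz σ, ← hg.2 z hz σ]
  algebraMap_mem' := by
    intro c
    exact ⟨Subalgebra.algebraMap_mem _ c, fun z _ σ => by simp⟩

/-!
A Bézout identity with symmetric `f i` persists when its coefficients are averaged over all
permutations of the coordinates, so it suffices to solve it in the full polydisc algebra. Dilating
by `r < 1` and applying Cauchy's formula one variable at a time shows that this algebra lies in the
uniform closure of the polynomials, a Banach algebra whose characters are the evaluations at the
points of the closed polydisc. By Gelfand theory, functions without a common zero there generate the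
unit ideal of that Banach algebra. Coefficients close to such a solution still give an invertible
sum, and dividing by it returns them to the polydisc algebra, which is closed under inverses.
-/

section BanachAlgebra

variable {ι : Type*} [Fintype ι]

theorem exists_sum_mul_eq_one_of_characters {A : Type*} [NormedCommRing A] [NormedAlgebra ℂ A]
    [CompleteSpace A] {f : ι → A}
    (hf : ∀ φ : WeakDual.characterSpace ℂ A, ∃ i, φ (f i) ≠ 0) :
    ∃ g : ι → A, ∑ i, f i * g i = 1 := by
  suffices Ideal.span (Set.range f) = ⊤ by
    rw [Ideal.eq_top_iff_one, Ideal.mem_span_range_iff_exists_fun] at this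
    simpa only [mul_comm] using this
  by_contra hI
  obtain ⟨M, hM, hle⟩ := Ideal.exists_le_maximal _ hI
  obtain ⟨i, hi⟩ := hf M.toCharacterSpace
  exact hi (M.toCharacterSpace_apply_eq_zero_of_mem (hle (Ideal.subset_span ⟨i, rfl⟩)))

theorem exists_mem_sum_mul_eq_one_of_topologicalClosure {𝕜 R : Type*} [CommSemiring 𝕜]
    [NormedRing R] [HasSummableGeomSeries R] [Algebra 𝕜 R] {A : Subalgebra 𝕜 R}
    (hA : ∀ u : Rˣ, (u : R) ∈ A → ((u⁻¹ : Rˣ) : R) ∈ A) {f g : ι → R} (hf : ∀ i, f i ∈ A)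
    (hg : ∀ i, g i ∈ A.topologicalClosure) (hfg : ∑ i, f i * g i = 1) :
    ∃ h : ι → R, (∀ i, h i ∈ A) ∧ ∑ i, f i * h i = 1 := by
  have hopen : IsOpen {p : ι → R | IsUnit (∑ i, f i * p i)} :=
    Units.isOpen.preimage (by fun_prop)
  have hclosure : g ∈ closure (Set.univ.pi fun _ => (A : Set R)) := by
    rw [closure_pi_set]
    exact fun i _ => hg i
  obtain ⟨p, ⟨u, hu⟩, hp⟩ := mem_closure_iff.1 hclosure _ hopen (by simp [hfg])
  have hpA : ∀ i, p i ∈ A := fun i => hp i (Set.mem_univ i)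
  have huA : (u : R) ∈ A := hu ▸ sum_mem fun i _ => mul_mem (hf i) (hpA i)
  refine ⟨fun i => p i * ↑u⁻¹, fun i => mul_mem (hpA i) (hA u huA), ?_⟩
  simp_rw [← mul_assoc]
  rw [← Finset.sum_mul, ← hu, u.mul_inv]

theorem algHom_ext_topologicalClosure_adjoin {R A B : Type*} [CommSemiring R] [Semiring A]
    [Algebra R A] [TopologicalSpace A] [IsTopologicalSemiring A] [Semiring B] [Algebra R B]
    [TopologicalSpace B] [T2Space B] {s : Set A}
    {φ ψ : (Algebra.adjoin R s).topologicalClosure →ₐ[R] B} (hφ : Continuous φ)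
    (hψ : Continuous ψ)
    (h : ∀ x (hx : x ∈ s),
      φ ⟨x, Subalgebra.le_topologicalClosure _ (Algebra.subset_adjoin hx)⟩ =
        ψ ⟨x, Subalgebra.le_topologicalClosure _ (Algebra.subset_adjoin hx)⟩) :
    φ = ψ := by
  let inc := Subalgebra.inclusion (Algebra.adjoin R s).le_topologicalClosure
  have hdense : DenseRange inc :=
    denseRange_inclusion_iff (Algebra.adjoin R s).le_topologicalClosure |>.2 subset_rfl
  have hcomp : φ.comp inc = ψ.comp inc := AlgHom.adjoin_ext h
  exact DFunLike.coe_injective (hdense.equalizer hφ hψ (congrArg DFunLike.coe hcomp))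

theorem resolvent_mem_of_isClosed {𝕜 A : Type*} [NormedField 𝕜] [NormedRing A]
    [NormedAlgebra 𝕜 A] [CompleteSpace A] [NormOneClass A] {B : Subalgebra 𝕜 A}
    (hB : IsClosed (B : Set A)) {a : A} (ha : a ∈ B) {ζ : 𝕜} (hζ : ‖a‖ < ‖ζ‖) :
    resolvent a ζ ∈ B := by
  have : CompleteSpace B := hB.completeSpace_coe
  have hnorm : ‖(1 : B)‖ = 1 := norm_one (α := A)
  obtain ⟨u, hu⟩ : ζ ∈ resolventSet 𝕜 (⟨a, ha⟩ : B) :=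
    spectrum.mem_resolventSet_of_norm_lt_mul (by rwa [hnorm, mul_one])
  have hua : (Units.map (B.val : B →* A) u : A) = algebraMap 𝕜 A ζ - a := congrArg B.val hu
  rw [resolvent, ← hua, Ring.inverse_unit]
  exact (u⁻¹ : Bˣ).1.2

end BanachAlgebra

section ContinuousFunctions

variable {X : Type*} [TopologicalSpace X] [CompactSpace X]

theorem exists_pos_le_sum_norm_of_sum_mul_eq_one {ι E : Type*} [Fintype ι] [NormedRing E]
    [NormOneClass E] {f g : ι → C(X, E)} (hfg : ∑ i, f i * g i = 1) :
    ∃ δ : ℝ, 0 < δ ∧ ∀ x, δ ≤ ∑ i, ‖f i x‖ := by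
  have hM : 0 < 1 + ∑ i, ‖g i‖ := by positivity
  have hgM (i : ι) (x : X) : ‖g i x‖ ≤ 1 + ∑ i, ‖g i‖ :=
    calc ‖g i x‖ ≤ ‖g i‖ := (g i).norm_coe_le_norm x
      _ ≤ ∑ i, ‖g i‖ :=
        Finset.single_le_sum (f := fun i => ‖g i‖) (fun i _ => norm_nonneg _) (Finset.mem_univ i)
      _ ≤ 1 + ∑ i, ‖g i‖ := le_add_of_nonneg_left zero_le_one
  refine ⟨(1 + ∑ i, ‖g i‖)⁻¹, inv_pos.2 hM, fun x => (inv_le_iff_one_le_mul₀ hM).2 ?_⟩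
  have hx : ∑ i, f i x * g i x = 1 := by simpa using DFunLike.congr_fun hfg x
  calc (1 : ℝ) = ‖∑ i, f i x * g i x‖ := by rw [hx, norm_one]
    _ ≤ ∑ i, ‖f i x‖ * ‖g i x‖ := norm_sum_le_of_le _ fun i _ => norm_mul_le _ _
    _ ≤ ∑ i, ‖f i x‖ * (1 + ∑ i, ‖g i‖) := by gcongr with i; exact hgM i x
    _ = (∑ i, ‖f i x‖) * (1 + ∑ i, ‖g i‖) := by rw [Finset.sum_mul]

theorem exists_mem_coe_eq_intervalIntegral {𝕜 E : Type*} [RCLike 𝕜] [NormedAddCommGroup E]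
    [NormedSpace 𝕜 E] [NormedSpace ℝ E] [CompleteSpace E] {S : Submodule 𝕜 C(X, E)}
    (hS : IsClosed (S : Set C(X, E))) (H : C(ℝ × X, E)) (hH : ∀ t, H.curry t ∈ S) (a b : ℝ) :
    ∃ s ∈ S, ⇑s = fun x => ∫ t in a..b, H (t, x) := by
  have := hS.completeSpace_coe
  let h : ℝ → S := fun t => ⟨H.curry t, hH t⟩
  have hcont : Continuous h := H.curry.continuous.subtype_mk _
  refine ⟨(∫ t in a..b, h t : S), SetLike.coe_mem _, funext fun x => ?_⟩
  exact (((ContinuousMap.evalCLM 𝕜 x).comp S.subtypeL).intervalIntegral_comp_comm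
    (hcont.intervalIntegrable a b)).symm

theorem resolvent_apply_of_norm_lt [Nonempty X] {a : C(X, ℂ)} {ζ : ℂ} (hζ : ‖a‖ < ‖ζ‖) (x : X) :
    resolvent a ζ x = (ζ - a x)⁻¹ := by
  have hunit : IsUnit (algebraMap ℂ C(X, ℂ) ζ - a) := spectrum.mem_resolventSet_of_norm_lt hζ
  refine eq_inv_of_mul_eq_one_right ?_
  simpa [resolvent] using DFunLike.congr_fun (Ring.mul_inverse_cancel _ hunit) x

open Metric

variable {B : Subalgebra ℂ C(X, ℂ)} (hB : IsClosed (B : Set C(X, ℂ)))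
include hB

theorem exists_mem_coe_eq_circleIntegral [Nonempty X] {a : C(X, ℂ)} (ha : a ∈ B) {ρ : ℝ}
    (haρ : ‖a‖ < ρ) {G : ℂ → X → ℂ} (hGB : ∀ ζ ∈ sphere 0 ρ, ∃ b ∈ B, ⇑b = G ζ)
    (hGcont : ContinuousOn G.uncurry (sphere 0 ρ ×ˢ Set.univ)) :
    ∃ b ∈ B, ⇑b = fun x => ∮ ζ in C(0, ρ), (ζ - a x)⁻¹ • G ζ x := by
  have hmem (θ : ℝ) : circleMap 0 ρ θ ∈ sphere 0 ρ :=
    circleMap_mem_sphere 0 ((norm_nonneg a).trans haρ.le) θ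
  have haθ (θ : ℝ) : ‖a‖ < ‖circleMap 0 ρ θ‖ := by rwa [mem_sphere_zero_iff_norm.1 (hmem θ)]
  have hne (θ : ℝ) (x : X) : circleMap 0 ρ θ - a x ≠ 0 := fun h =>
    ((a.norm_coe_le_norm x).trans_lt (haθ θ)).ne (by rw [sub_eq_zero.1 h])
  have hcircle : Continuous fun p : ℝ × X => circleMap 0 ρ p.1 :=
    (continuous_circleMap 0 ρ).comp continuous_fst
  have hG : Continuous fun p : ℝ × X => G (circleMap 0 ρ p.1) p.2 :=
    hGcont.comp_continuous (hcircle.prodMk continuous_snd) fun p => ⟨hmem p.1, trivial⟩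
  have hinv : Continuous fun p : ℝ × X => (circleMap 0 ρ p.1 - a p.2)⁻¹ :=
    (hcircle.sub (by fun_prop)).inv₀ fun p => hne p.1 p.2
  let H : C(ℝ × X, ℂ) :=
    { toFun p := deriv (circleMap 0 ρ) p.1 •
        (circleMap 0 ρ p.1 - a p.2)⁻¹ • G (circleMap 0 ρ p.1) p.2
      continuous_toFun := by
        simp only [deriv_circleMap]
        exact (hcircle.mul continuous_const).smul (hinv.smul hG) }
  refine exists_mem_coe_eq_intervalIntegral (S := B.toSubmodule) hB H (fun θ => ?_) 0 (2 * Real.pi)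
  obtain ⟨b, hb, hbG⟩ := hGB _ (hmem θ)
  have hH : H.curry θ = deriv (circleMap 0 ρ) θ • (resolvent a (circleMap 0 ρ θ) * b) := by
    ext x
    simp [H, hbG, resolvent_apply_of_norm_lt (haθ θ)]
  rw [hH]
  exact B.smul_mem (mul_mem (resolvent_mem_of_isClosed hB ha (haθ θ)) hb) _

theorem exists_mem_coe_eq_of_differentiableOn_ball [Nonempty X] {a : C(X, ℂ)} (ha : a ∈ B) {R : ℝ}
    (haR : ‖a‖ < R) {G : ℂ → X → ℂ} (hGB : ∀ ζ ∈ ball 0 R, ∃ b ∈ B, ⇑b = G ζ)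
    (hGcont : ContinuousOn G.uncurry (ball 0 R ×ˢ Set.univ))
    (hGdiff : ∀ x, DifferentiableOn ℂ (G · x) (ball 0 R)) :
    ∃ b ∈ B, ⇑b = fun x => G (a x) x := by
  obtain ⟨ρ, haρ, hρR⟩ := exists_between haR
  have hsphere : sphere (0 : ℂ) ρ ⊆ ball 0 R := sphere_subset_ball hρR
  have hclosure : closure (ball (0 : ℂ) ρ) ⊆ ball 0 R :=
    closure_ball_subset_closedBall.trans (closedBall_subset_ball hρR)
  obtain ⟨c, hc, hcG⟩ := exists_mem_coe_eq_circleIntegral hB ha haρ (fun ζ hζ => hGB ζ (hsphere hζ))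
    (hGcont.mono (Set.prod_mono hsphere subset_rfl))
  refine ⟨(2 * Real.pi * Complex.I : ℂ)⁻¹ • c, B.smul_mem hc _, funext fun x => ?_⟩
  rw [ContinuousMap.coe_smul, hcG]
  exact ((hGdiff x).mono hclosure).diffContOnCl.two_pi_i_inv_smul_circleIntegral_sub_inv_smul
    (mem_ball_zero_iff.2 ((a.norm_coe_le_norm x).trans_lt haρ))

-- Only the coordinates in `s` are substituted: the induction on `s` applies Cauchy's formula in one
-- variable at a time.
theorem exists_mem_coe_eq_comp_piecewise [Nonempty X] {ι : Type*} [Finite ι] [DecidableEq ι]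
    {a : ι → C(X, ℂ)} (ha : ∀ i, a i ∈ B) {R : ι → ℝ} (haR : ∀ i, ‖a i‖ < R i) {F : (ι → ℂ) → ℂ}
    (hF : DifferentiableOn ℂ F {z | ∀ i, ‖z i‖ < R i}) (s : Finset ι) {w : ι → ℂ}
    (hw : ∀ i, ‖w i‖ < R i) :
    ∃ b ∈ B, ⇑b = fun x => F (s.piecewise (fun i => a i x) w) := by
  have := Fintype.ofFinite ι
  induction s using Finset.induction_on generalizing w with
  | empty => exact ⟨algebraMap ℂ _ (F w), B.algebraMap_mem _, by ext; simp⟩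
  | insert j s hj ih =>
    let P (ζ : ℂ) (x : X) : ι → ℂ := Function.update (s.piecewise (fun i => a i x) w) j ζ
    have hP {ζ : ℂ} (hζ : ζ ∈ ball 0 (R j)) (x : X) (i : ι) : ‖P ζ x i‖ < R i := by
      obtain rfl | hij := eq_or_ne i j
      · simpa [P] using hζ
      · by_cases his : i ∈ s
        · simpa [P, hij, his] using ((a i).norm_coe_le_norm x).trans_lt (haR i)
        · simpa [P, hij, his] using hw i
    have hPcont : Continuous P.uncurry := by
      refine Continuous.update (continuous_pi fun i => ?_) j continuous_fst
      by_cases his : i ∈ s <;> simp only [his, Finset.piecewise, if_true, if_false] <;> fun_prop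
    have hPdiff (x : X) : Differentiable ℂ (P · x) := fun ζ =>
      (hasDerivAt_update _ j ζ).differentiableAt
    simp_rw [Finset.piecewise_insert]
    refine exists_mem_coe_eq_of_differentiableOn_ball hB (ha j) (haR j) (G := fun ζ x => F (P ζ x))
      (fun ζ hζ => ?_) ?_ fun x => ?_
    · simp_rw [P, Finset.update_piecewise_of_notMem _ _ _ hj]
      refine ih fun i => ?_
      obtain rfl | hij := eq_or_ne i j
      · simpa using hζ
      · simpa [hij] using hw i
    · exact hF.continuousOn.comp hPcont.continuousOn fun p hp => hP hp.1 p.2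
    · exact hF.comp (hPdiff x).differentiableOn fun ζ hζ => hP hζ x

theorem exists_mem_coe_eq_comp_of_differentiableOn [Nonempty X] {ι : Type*} [Finite ι]
    {a : ι → C(X, ℂ)} (ha : ∀ i, a i ∈ B) {R : ι → ℝ} (haR : ∀ i, ‖a i‖ < R i) {F : (ι → ℂ) → ℂ}
    (hF : DifferentiableOn ℂ F {z | ∀ i, ‖z i‖ < R i}) :
    ∃ b ∈ B, ⇑b = fun x => F fun i => a i x := by
  classical
  have := Fintype.ofFinite ι
  have h0 (i : ι) : ‖(0 : ι → ℂ) i‖ < R i := by simpa using (norm_nonneg _).trans_lt (haR i)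
  simpa using exists_mem_coe_eq_comp_piecewise hB ha haR hF Finset.univ h0

end ContinuousFunctions

section Polydisc

variable {d : ℕ}

instance closedPolydisc.instCompactSpace : CompactSpace (closedPolydisc d) := by
  have h : closedPolydisc d = Set.univ.pi fun _ => Metric.closedBall (0 : ℂ) 1 := by
    ext z
    simp [closedPolydisc]
  rw [← isCompact_iff_compactSpace, h]
  exact isCompact_univ_pi fun _ => isCompact_closedBall 0 1

theorem continuous_closedPolydisc_apply (i : Fin d) :
    Continuous fun z : closedPolydisc d => z.1 i :=
  (continuous_apply i).comp continuous_subtype_val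

instance closedPolydisc.instNonempty : Nonempty (closedPolydisc d) :=
  ⟨⟨0, fun i => by simp⟩⟩

/-- The dilations `z ↦ r z` of the closed polydisc, for `0 ≤ r ≤ 1`, as one jointly continuous map;
they push the closed polydisc into the open one. -/
def polydiscDilation : C(unitInterval × closedPolydisc d, closedPolydisc d) where
  toFun p := ⟨fun i => (p.1 : ℂ) * p.2.1 i, fun i => by
    rw [norm_mul, Complex.norm_real, Real.norm_of_nonneg p.1.2.1]
    exact mul_le_one₀ p.1.2.2 (norm_nonneg _) (p.2.2 i)⟩
  continuous_toFun :=
    Continuous.subtype_mk (continuous_pi fun i => Continuous.mul (by fun_prop)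
      ((continuous_closedPolydisc_apply i).comp continuous_snd)) _

theorem polydiscDilation_mem_openPolydisc {r : unitInterval} (hr : r < 1) (z : closedPolydisc d) :
    (polydiscDilation (r, z)).1 ∈ openPolydisc d := fun i => by
  change ‖(r : ℂ) * z.1 i‖ < 1
  rw [norm_mul, Complex.norm_real, Real.norm_of_nonneg r.2.1]
  exact mul_lt_one_of_nonneg_of_lt_one_left r.2.1 hr (z.2 i)

theorem curry_comp_polydiscDilation_one (f : C(closedPolydisc d, ℂ)) :
    (f.comp polydiscDilation).curry 1 = f := by
  ext z
  simp [polydiscDilation]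

theorem unitInterval_one_mem_closure_Iio : (1 : unitInterval) ∈ closure (Set.Iio 1) := by
  rw [closure_Iio' ⟨0, zero_lt_one⟩]
  exact Set.self_mem_Iic

theorem dense_openPolydisc : Dense {z : closedPolydisc d | z.1 ∈ openPolydisc d} := fun z => by
  have h := map_mem_closure (f := fun r => polydiscDilation (r, z))
    (t := {z : closedPolydisc d | z.1 ∈ openPolydisc d}) (by fun_prop)
    unitInterval_one_mem_closure_Iio fun r hr => polydiscDilation_mem_openPolydisc hr z
  simpa [polydiscDilation] using h

/-- The `i`-th coordinate function `z ↦ zᵢ` on the closed polydisc. -/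
def polydiscCoord (i : Fin d) : C(closedPolydisc d, ℂ) :=
  ⟨fun z => z.1 i, continuous_closedPolydisc_apply i⟩

theorem norm_polydiscCoord_le (i : Fin d) : ‖polydiscCoord i‖ ≤ 1 :=
  (ContinuousMap.norm_le _ zero_le_one).2 fun z => z.2 i

variable (d) in
/-- The uniform closure `P(𝔻^d)` of the polynomials in `C(closedPolydisc d, ℂ)`. Unlike
`polydiscAlgebra d`, with which it agrees, it is closed by construction, hence visibly a Banach
algebra. -/
noncomputable def polydiscUniformAlgebra : Subalgebra ℂ C(closedPolydisc d, ℂ) :=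
  (Algebra.adjoin ℂ (Set.range polydiscCoord)).topologicalClosure

theorem isClosed_polydiscUniformAlgebra :
    IsClosed (polydiscUniformAlgebra d : Set C(closedPolydisc d, ℂ)) :=
  Subalgebra.isClosed_topologicalClosure _

instance polydiscUniformAlgebra.instCompleteSpace : CompleteSpace (polydiscUniformAlgebra d) :=
  isClosed_polydiscUniformAlgebra.completeSpace_coe

theorem polydiscCoord_mem_polydiscUniformAlgebra (i : Fin d) :
    polydiscCoord i ∈ polydiscUniformAlgebra d :=
  Subalgebra.le_topologicalClosure _ (Algebra.subset_adjoin ⟨i, rfl⟩)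

theorem polydiscUniformAlgebra_le_topologicalClosure_polydiscAlgebra :
    polydiscUniformAlgebra d ≤ (polydiscAlgebra d).topologicalClosure := by
  refine Subalgebra.topologicalClosure_mono (Algebra.adjoin_le ?_)
  rintro _ ⟨i, rfl⟩
  exact (isHolomorphicInside_iff _).2 ⟨fun z => z i, by fun_prop, fun _ _ => rfl⟩

theorem curry_comp_polydiscDilation_mem {f : C(closedPolydisc d, ℂ)} (hf : f ∈ polydiscAlgebra d)
    {r : unitInterval} (hr : r < 1) :
    (f.comp polydiscDilation).curry r ∈ polydiscUniformAlgebra d := by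
  obtain ⟨F, hF, hFf⟩ := (isHolomorphicInside_iff _).1 hf
  have hnorm (i : Fin d) : ‖(r : ℂ) • polydiscCoord i‖ < 1 := by
    rw [norm_smul, Complex.norm_real, Real.norm_of_nonneg r.2.1]
    exact mul_lt_one_of_nonneg_of_lt_one_left r.2.1 hr (norm_polydiscCoord_le i)
  obtain ⟨b, hb, hbF⟩ := exists_mem_coe_eq_comp_of_differentiableOn isClosed_polydiscUniformAlgebra
    (fun i => Subalgebra.smul_mem _ (polydiscCoord_mem_polydiscUniformAlgebra i) (r : ℂ)) hnorm hF
  convert hb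
  ext z
  rw [hbF]
  exact (hFf _ (polydiscDilation_mem_openPolydisc hr z)).symm

theorem polydiscAlgebra_le_polydiscUniformAlgebra : polydiscAlgebra d ≤ polydiscUniformAlgebra d :=
  fun f hf => by
  have h := map_mem_closure (f.comp polydiscDilation).curry.continuous
    unitInterval_one_mem_closure_Iio fun r hr => curry_comp_polydiscDilation_mem hf hr
  rwa [isClosed_polydiscUniformAlgebra.closure_eq, curry_comp_polydiscDilation_one] at h

theorem exists_eval_of_character (φ : WeakDual.characterSpace ℂ (polydiscUniformAlgebra d)) :
    ∃ z : closedPolydisc d, ∀ b : polydiscUniformAlgebra d, φ b = b.1 z := by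
  let coord (i : Fin d) : polydiscUniformAlgebra d :=
    ⟨polydiscCoord i, polydiscCoord_mem_polydiscUniformAlgebra i⟩
  have hone : ‖(1 : polydiscUniformAlgebra d)‖ = 1 := norm_one (α := C(closedPolydisc d, ℂ))
  have hφ (i : Fin d) : ‖φ (coord i)‖ ≤ 1 :=
    calc ‖φ (coord i)‖ ≤ ‖coord i‖ * ‖(1 : polydiscUniformAlgebra d)‖ :=
          spectrum.norm_le_norm_mul_of_mem (AlgHom.apply_mem_spectrum φ (coord i))
      _ = ‖polydiscCoord i‖ := by
          rw [hone, mul_one]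
          rfl
      _ ≤ 1 := norm_polydiscCoord_le i
  let z : closedPolydisc d := ⟨fun i => φ (coord i), hφ⟩
  let ev : polydiscUniformAlgebra d →ₐ[ℂ] ℂ :=
    (ContinuousMap.evalAlgHom ℂ ℂ z).comp (polydiscUniformAlgebra d).val
  have hev : Continuous ev := (continuous_eval_const z).comp continuous_subtype_val
  have h : WeakDual.CharacterSpace.toAlgHom φ = ev :=
    algHom_ext_topologicalClosure_adjoin (map_continuous φ) hev (by rintro _ ⟨i, rfl⟩; rfl)
  exact ⟨z, DFunLike.congr_fun h⟩

theorem inv_mem_polydiscAlgebra (u : C(closedPolydisc d, ℂ)ˣ)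
    (hu : (u : C(closedPolydisc d, ℂ)) ∈ polydiscAlgebra d) :
    ((u⁻¹ : C(closedPolydisc d, ℂ)ˣ) : C(closedPolydisc d, ℂ)) ∈ polydiscAlgebra d := by
  obtain ⟨F, hF, hFu⟩ := (isHolomorphicInside_iff _).1 hu
  have hinv (z : closedPolydisc d) : u.1 z * u⁻¹.1 z = 1 := DFunLike.congr_fun u.mul_inv z
  refine (isHolomorphicInside_iff _).2 ⟨fun z => (F z)⁻¹, hF.inv fun z hz => ?_, fun z hz => ?_⟩
  · rw [hFu ⟨z, openPolydisc_subset_closedPolydisc d hz⟩ hz]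
    exact left_ne_zero_of_mul_eq_one (hinv _)
  · change (F z)⁻¹ = _
    rw [hFu z hz]
    exact (eq_inv_of_mul_eq_one_right (hinv z)).symm

theorem exists_sum_mul_eq_one_polydiscAlgebra {ι : Type*} [Fintype ι]
    {f : ι → C(closedPolydisc d, ℂ)} (hf : ∀ i, f i ∈ polydiscAlgebra d)
    (hf0 : ∀ z, ∃ i, f i z ≠ 0) :
    ∃ g : ι → C(closedPolydisc d, ℂ), (∀ i, g i ∈ polydiscAlgebra d) ∧ ∑ i, f i * g i = 1 := by
  let f' (i : ι) : polydiscUniformAlgebra d :=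
    ⟨f i, polydiscAlgebra_le_polydiscUniformAlgebra (hf i)⟩
  obtain ⟨g, hg⟩ : ∃ g : ι → polydiscUniformAlgebra d, ∑ i, f' i * g i = 1 := by
    refine exists_sum_mul_eq_one_of_characters fun φ => ?_
    obtain ⟨z, hz⟩ := exists_eval_of_character φ
    exact (hf0 z).imp fun i hi => by rwa [hz]
  refine exists_mem_sum_mul_eq_one_of_topologicalClosure (g := fun i => (g i).1)
    inv_mem_polydiscAlgebra hf
    (fun i => polydiscUniformAlgebra_le_topologicalClosure_polydiscAlgebra (g i).2) ?_
  simpa using congrArg Subtype.val hg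

/-- `permPoint σ` as a continuous map. -/
def permPointMap (σ : Equiv.Perm (Fin d)) : C(closedPolydisc d, closedPolydisc d) :=
  ⟨permPoint σ, Continuous.subtype_mk
    (continuous_pi fun i => continuous_closedPolydisc_apply (σ i)) _⟩

theorem comp_permPointMap_mem_polydiscAlgebra {f : C(closedPolydisc d, ℂ)}
    (hf : f ∈ polydiscAlgebra d) (σ : Equiv.Perm (Fin d)) :
    f.comp (permPointMap σ) ∈ polydiscAlgebra d := by
  obtain ⟨F, hF, hFf⟩ := (isHolomorphicInside_iff _).1 hf
  exact (isHolomorphicInside_iff _).2 ⟨fun z => F fun i => z (σ i),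
    hF.comp (by fun_prop) fun z hz i => hz (σ i),
    fun z hz => hFf (permPoint σ z) fun i => hz (σ i)⟩

theorem apply_permPoint_of_mem_symPolydiscAlgebra {f : C(closedPolydisc d, ℂ)}
    (hf : f ∈ symPolydiscAlgebra d) (σ : Equiv.Perm (Fin d)) (z : closedPolydisc d) :
    f (permPoint σ z) = f z :=
  congrFun (Continuous.ext_on dense_openPolydisc (f.comp (permPointMap σ)).continuous f.continuous
    fun z hz => (hf.2 z hz σ).symm) z

variable (d) in
/-- The average over all permutations of the coordinates: the Reynolds operator onto the symmetric
functions. -/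
noncomputable def symAverage : C(closedPolydisc d, ℂ) →ₗ[ℂ] C(closedPolydisc d, ℂ) :=
  (Fintype.card (Equiv.Perm (Fin d)) : ℂ)⁻¹ •
    ∑ σ, (ContinuousMap.compRightAlgHom ℂ ℂ (permPointMap σ)).toLinearMap

theorem symAverage_apply (f : C(closedPolydisc d, ℂ)) (z : closedPolydisc d) :
    symAverage d f z = (Fintype.card (Equiv.Perm (Fin d)) : ℂ)⁻¹ * ∑ σ, f (permPoint σ z) := by
  simp only [symAverage, LinearMap.smul_apply, LinearMap.sum_apply, ContinuousMap.smul_apply,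
    ContinuousMap.sum_apply, smul_eq_mul]
  rfl

theorem symAverage_mem_symPolydiscAlgebra {f : C(closedPolydisc d, ℂ)}
    (hf : f ∈ polydiscAlgebra d) : symAverage d f ∈ symPolydiscAlgebra d := by
  refine ⟨?_, fun z _ τ => ?_⟩
  · rw [symAverage, LinearMap.smul_apply, LinearMap.sum_apply]
    exact Subalgebra.smul_mem _
      (sum_mem fun σ _ => comp_permPointMap_mem_polydiscAlgebra hf σ) _
  · rw [symAverage_apply, symAverage_apply]
    congr 1
    exact (Fintype.sum_equiv (Equiv.mulLeft τ) _ _ fun σ => rfl).symm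

theorem symAverage_one : symAverage d 1 = 1 := by
  ext z
  simp [symAverage_apply]

theorem symAverage_mul_of_mem {f : C(closedPolydisc d, ℂ)} (hf : f ∈ symPolydiscAlgebra d)
    (g : C(closedPolydisc d, ℂ)) : symAverage d (f * g) = f * symAverage d g := by
  ext z
  simp only [symAverage_apply, ContinuousMap.mul_apply,
    apply_permPoint_of_mem_symPolydiscAlgebra hf, ← Finset.mul_sum, mul_left_comm]

end Polydisc

theorem theorem2p1 (d : ℕ) (hd : 1 ≤ d) (n : ℕ) (hn : 1 ≤ n)
    (f : Fin n → symPolydiscAlgebra d) :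
    (∃ g : Fin n → symPolydiscAlgebra d, ∑ i, f i * g i = 1) ↔
      ∃ δ : ℝ, 0 < δ ∧ ∀ z : closedPolydisc d, z.1 ∈ openPolydisc d →
        δ ≤ ∑ i, ‖(f i : C(closedPolydisc d, ℂ)) z‖ := by
  constructor
  · rintro ⟨g, hg⟩
    have hfg : ∑ i, (f i).1 * (g i).1 = 1 := by simpa using congrArg Subtype.val hg
    obtain ⟨δ, hδ, h⟩ := exists_pos_le_sum_norm_of_sum_mul_eq_one hfg
    exact ⟨δ, hδ, fun z _ => h z⟩
  · rintro ⟨δ, hδ, h⟩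
    have hclosed : IsClosed {z | δ ≤ ∑ i, ‖(f i).1 z‖} := isClosed_le (by fun_prop) (by fun_prop)
    have hbound (z : closedPolydisc d) : δ ≤ ∑ i, ‖(f i).1 z‖ :=
      hclosed.closure_subset_iff.2 h (dense_openPolydisc z)
    have hf0 (z : closedPolydisc d) : ∃ i, (f i).1 z ≠ 0 := by
      by_contra! h0
      exact (hbound z).not_gt (by simpa [h0] using hδ)
    obtain ⟨g, hgA, hg⟩ := exists_sum_mul_eq_one_polydiscAlgebra (fun i => (f i).2.1) hf0
    refine ⟨fun i => ⟨symAverage d (g i), symAverage_mem_symPolydiscAlgebra (hgA i)⟩,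
      Subtype.ext ?_⟩
    calc _ = ∑ i, (f i).1 * symAverage d (g i) := by simp
      _ = symAverage d (∑ i, (f i).1 * g i) := by
        simp only [map_sum, symAverage_mul_of_mem (f _).2]
      _ = 1 := by rw [hg, symAverage_one]
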